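/- Let $n\ge 1$ and $N=2^n$. The qTTN ansatz $U_N$ on $N$ qubits, applied to $|0\rangle^{\otimes N}$, is defined recursively. Write $R_X(\theta)=e^{-i\theta X/2}$, $R_Z(\theta)=e^{-i\theta Z/2}$. For $N=2$, apply in this order: $R_X$ and then $R_Z$ to each qubit, a CNOT with control qubit $1$ and target qubit $2$, and again $R_X$ and then $R_Z$ to each qubit. For $N=2^n$ with $n>1$: apply $R_X$ and then $R_Z$ to qubits $1$ and $N/2+1$ (the first qubit of each half), then a CNOT with control $1$ and target $N/2+1$, and then a copy of $U_{N/2}$ to qubits $1,\dots,N/2$ and another copy to qubits $N/2+1,\dots,N$. Every rotation gate has its own parameter, and all parameters are independent and uniformly distributed on $[-\pi,\pi]$. Let $\langle X_i\rangle=\langle 0|^{\otimes N}U_N^\dagger X_iU_N|0\rangle^{\otimes N}$, where $X_i$ is the Pauli $X$ operator on qubit $i$, and let $\partial_{1,1}$ be the partial derivative with respect to the first parameter on the first qubit (the first $R_X$ applied to qubit $1$). Let $V_i(n)=\mathrm{Var}[\partial_{1,1}\langle X_i\rangle]$ be the variance over the random parameters. Then: 1. $V_1(n)\ge V_i(n)\ge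 V_N(n)$ for all $n\ge 1$ and all $i=1,\dots,N$. 2. $V_N(n)=\frac14\left(\frac38\right)^n$ for all $n\ge1$. 3. $V_1(n)\in\Omega\big((\lambda_2/4)^n\big)$, where $\lambda_2\approx 2.3187$ is the largest eigenvalue of $\frac14\begin{pmatrix}3&8\\1&8\end{pmatrix}$; that is, there is $c>0$ with $V_1(n)\ge c(\lambda_2/4)^n$ for all $n\ge1$. 4. Consequently all these variances decay polynomially, and only polynomially, in $N$: there are constants $c,C,a,b>0$ with $c\,N^{-a}\le V_i(n)\le C\,N^{-b}$ for all $n\ge1$ and all $i=1,\dots,N$. -/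

import Mathlib

open MeasureTheory ProbabilityTheory

noncomputable section

namespace QTTN

/-- The Pauli `X` matrix. -/
def pauliX : Matrix (Fin 2) (Fin 2) ℂ := !![0, 1; 1, 0]

/-- The Pauli `Z` matrix. -/
def pauliZ : Matrix (Fin 2) (Fin 2) ℂ := !![1, 0; 0, -1]

/-- The one-qubit rotation `R_X(t) = exp(-i t X / 2)`. -/
def RX (t : ℝ) : Matrix (Fin 2) (Fin 2) ℂ :=
  NormedSpace.exp ((-(Complex.I * (t : ℂ) / 2)) • pauliX)

/-- The one-qubit rotation `R_Z(t) = exp(-i t Z / 2)`. -/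
def RZ (t : ℝ) : Matrix (Fin 2) (Fin 2) ℂ :=
  NormedSpace.exp ((-(Complex.I * (t : ℂ) / 2)) • pauliZ)

/-- Operators on the Hilbert space of a register of qubits labelled by `Q`; the computational
basis states are the bit strings `Q → Fin 2`. -/
abbrev Op (Q : Type) : Type := Matrix (Q → Fin 2) (Q → Fin 2) ℂ

section Gates

variable {Q : Type} [Fintype Q] [DecidableEq Q]

/-- The one-qubit operator `A` acting on qubit `q` (and trivially on all other qubits). -/
def onQubit (q : Q) (A : Matrix (Fin 2) (Fin 2) ℂ) : Op Q :=
  fun b b' => if ∀ r, r ≠ q → b r = b' r then A (b q) (b' q) else 0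

/-- The controlled-`X` gate with control `c` and target `t`: it maps the basis state `b'` to the
basis state in which bit `t` is replaced by `b' t ⊕ b' c` (addition in `Fin 2` is XOR). -/
def cnot (c t : Q) : Op Q :=
  fun b b' => if b = Function.update b' t (b' t + b' c) then 1 else 0

/-- The state `|0…0⟩`. -/
def zeroState : (Q → Fin 2) → ℂ := Pi.single (fun _ => 0) 1

/-- `⟨ψ| H |ψ⟩` for the state `ψ = U |0…0⟩` (a real number when `H` is Hermitian). -/
def expectation (U H : Op Q) : ℝ :=
  (star (U.mulVec zeroState) ⬝ᵥ H.mulVec (U.mulVec zeroState)).re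

end Gates

/-- One parameter label for each rotation gate of the ansatz on `2 ^ n` qubits.
* `n = 0`: `0` is the `R_X` and `1` the `R_Z` on the only qubit.
* `n + 1`: `Sum.inl (h, 0)` is the `R_X` and `Sum.inl (h, 1)` the `R_Z` of the top recursion level
  on the first qubit of the upper half (`h = 0`) or of the lower half (`h = 1`);
  `Sum.inr (Sum.inl p)` and `Sum.inr (Sum.inr p)` are the parameters of the copies of the
  `2 ^ n`-qubit circuit on the upper and on the lower half. -/
def Param : ℕ → Type
  | 0 => Fin 2
  | n + 1 => (Fin 2 × Fin 2) ⊕ (Param n ⊕ Param n)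

instance instDecidableEqParam : ∀ n, DecidableEq (Param n)
  | 0 => inferInstanceAs (DecidableEq (Fin 2))
  | n + 1 =>
    haveI := instDecidableEqParam n
    inferInstanceAs (DecidableEq ((Fin 2 × Fin 2) ⊕ (Param n ⊕ Param n)))

instance instFintypeParam : ∀ n, Fintype (Param n)
  | 0 => inferInstanceAs (Fintype (Fin 2))
  | n + 1 =>
    haveI := instFintypeParam n
    inferInstanceAs (Fintype ((Fin 2 × Fin 2) ⊕ (Param n ⊕ Param n)))

/-- The parameter `(1,1)`: the first rotation (an `R_X`) on the first qubit. -/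
def param11 : ∀ n, Param n
  | 0 => (0 : Fin 2)
  | _ + 1 => Sum.inl (0, 0)

/-- Inclusion of the upper half (qubits `0, …, 2 ^ n - 1`) into the register of `2 ^ (n + 1)`
qubits. -/
def upper (n : ℕ) (i : Fin (2 ^ n)) : Fin (2 ^ (n + 1)) :=
  ⟨i, by have := i.isLt; rw [pow_succ]; omega⟩

/-- Inclusion of the lower half (qubits `2 ^ n, …, 2 ^ (n + 1) - 1`) into the register of
`2 ^ (n + 1)` qubits. -/
def lower (n : ℕ) (i : Fin (2 ^ n)) : Fin (2 ^ (n + 1)) :=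
  ⟨2 ^ n + i, by have := i.isLt; rw [pow_succ]; omega⟩

/-- The first qubit of the register of `2 ^ n` qubits. -/
def firstQubit (n : ℕ) : Fin (2 ^ n) := ⟨0, by positivity⟩

/-- The last qubit of the register of `2 ^ n` qubits. -/
def lastQubit (n : ℕ) : Fin (2 ^ n) := ⟨2 ^ n - 1, Nat.sub_lt (by positivity) one_pos⟩

/-- The qTTN circuit on `2 ^ n` qubits, placed on those qubits of a register `Q` that are listed
by `e`.  Matrix products are read from right to left in time.  Step `n + 1` applies `R_X`, then
`R_Z`, to the first qubit of each half, then `CNOT` from the first qubit of the upper half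
(control) to the first qubit of the lower half (target), then the `2 ^ n`-qubit circuit to each
half.  The one-qubit circuit is `R_X` followed by `R_Z`, so that for two qubits one gets
`R_X`, `R_Z` on both qubits, `CNOT`, and again `R_X`, `R_Z` on both qubits. -/
def circuitOn {Q : Type} [Fintype Q] [DecidableEq Q] :
    ∀ n : ℕ, (Fin (2 ^ n) → Q) → (Param n → ℝ) → Op Q
  | 0, e, θ =>
    onQubit (e (firstQubit 0)) (RZ (θ (1 : Fin 2))) *
      onQubit (e (firstQubit 0)) (RX (θ (0 : Fin 2)))
  | n + 1, e, θ =>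
    let a : Q := e (upper n (firstQubit n))
    let b : Q := e (lower n (firstQubit n))
    circuitOn n (e ∘ lower n) (fun p => θ (Sum.inr (Sum.inr p))) *
      circuitOn n (e ∘ upper n) (fun p => θ (Sum.inr (Sum.inl p))) *
      cnot a b *
      (onQubit b (RZ (θ (Sum.inl (1, 1)))) * onQubit a (RZ (θ (Sum.inl (0, 1))))) *
      (onQubit b (RX (θ (Sum.inl (1, 0)))) * onQubit a (RX (θ (Sum.inl (0, 0)))))

/-- The qTTN ansatz on `N = 2 ^ n` qubits. -/
def circuit (n : ℕ) (θ : Param n → ℝ) : Op (Fin (2 ^ n)) := circuitOn n id θ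

/-- The cost function `⟨X_i⟩` as a function of the parameters. -/
def cost (n : ℕ) (i : Fin (2 ^ n)) (θ : Param n → ℝ) : ℝ :=
  expectation (circuit n θ) (onQubit i pauliX)

/-- The partial derivative of `⟨X_i⟩` with respect to the parameter `p`. -/
def gradient (n : ℕ) (p : Param n) (i : Fin (2 ^ n)) (θ : Param n → ℝ) : ℝ :=
  deriv (fun t => cost n i (Function.update θ p t)) (θ p)

/-- All parameters independent and uniformly distributed on `[-π, π]`. -/
def uniformParams (n : ℕ) : Measure (Param n → ℝ) :=
  Measure.pi fun _ => cond (volume : Measure ℝ) (Set.Icc (-Real.pi) Real.pi)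

/-- `Var[∂_{1,1} ⟨X_i⟩]` for the qTTN ansatz on `2 ^ n` qubits. -/
def gradVar (n : ℕ) (i : Fin (2 ^ n)) : ℝ :=
  variance (gradient n (param11 n) i) (uniformParams n)

/-- The transfer matrix `(1/4) [[3, 8], [1, 8]]`. -/
def transferMatrix : Matrix (Fin 2) (Fin 2) ℝ := (1 / 4 : ℝ) • !![3, 8; 1, 8]

end QTTN

end

/-!
The proof works in the Heisenberg picture. Suppose that all qubits of a block of `2 ^ n` qubits
except its first enter in the state `|0⟩`. Then the expectation of `X_i` after the circuit on this
block equals the expectation before it of an observable `w I + x X + y Y + z Z` on the first qubit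
alone (`quadForm_circuitOn`). Its coordinates `pauliObs` obey a recursion in `n`. Since
`CNOT = |0⟩⟨0| ⊗ 1 + |1⟩⟨1| ⊗ X`, an observable on the control keeps its diagonal part and has its
off-diagonal part multiplied by the expectation of `X` on the target, while an observable on the
target becomes diagonal on the control (`cnot_conj_control`, `cnot_conj_target`). The rotations of
the first qubit then rotate `(x, y, z)`. The half of the register that does not contain qubit `i`
plays no role, because its circuit is unitary and commutes with the observable.

The parameter `(1,1)` is the angle of the first gate in time, hence of the last rotation of
`(x, y, z)`, about the `X` axis. Therefore the partial derivative of `⟨X_i⟩ = w + z` is `-y`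
(`gradient_eq`), its mean is zero, and the variance is the second moment of `y`, which equals that
of `z`. Averaging a rotation over its angle replaces two second moments by their mean
(`integral_rotate_sq`), so with `X = E x²` and `Y = E y² = E z²` the moments satisfy

* for `i` in the upper half: `X' = (X + Y) / 8` and `Y' = (X + Y) / 16 + Y / 2`;
* for `i` in the lower half: `X' = 0` and `Y' = 3 / 8 * Y`,

with initial values `X = 1 / 2` and `Y = 1 / 4`. The upper step dominates the lower step and both
are monotone, which gives the ordering. The last qubit takes only lower steps, which gives
`1 / 4 * (3 / 8) ^ n`. The first qubit takes only upper steps, under which `(X + Y, Y)` evolves by a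
quarter of the transfer matrix; comparing it with multiples of the positive eigenvector gives the
rate `λ / 4` with matching upper and lower bounds (`moments_firstQubit_bounds`).
-/

/-! ### Rotations of one-qubit observables -/

namespace QTTN
open Matrix

theorem RZ_eq (t : ℝ) :
    RZ t = !![Complex.cos (t / 2) - Complex.I * Complex.sin (t / 2), 0;
      0, Complex.cos (t / 2) + Complex.I * Complex.sin (t / 2)] := by
  have h : (-(Complex.I * (t : ℂ) / 2)) • pauliZ =
      diagonal ![-(t / 2 : ℂ) * Complex.I, (t / 2 : ℂ) * Complex.I] := by
    ext i j
    fin_cases i <;> fin_cases j <;> simp [pauliZ] <;> ring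
  have hv : NormedSpace.exp ![-(t / 2 : ℂ) * Complex.I, (t / 2 : ℂ) * Complex.I] =
      ![Complex.exp (-(t / 2 : ℂ) * Complex.I), Complex.exp ((t / 2 : ℂ) * Complex.I)] := by
    ext i
    rw [Pi.coe_exp, ← Complex.exp_eq_exp_ℂ]
    fin_cases i <;> rfl
  rw [RZ, h, exp_diagonal, hv, Complex.exp_mul_I, Complex.exp_mul_I]
  ext i j
  fin_cases i <;> fin_cases j <;> simp <;> ring

theorem RX_eq (t : ℝ) :
    RX t = !![Complex.cos (t / 2), -(Complex.I * Complex.sin (t / 2));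
      -(Complex.I * Complex.sin (t / 2)), Complex.cos (t / 2)] := by
  -- The Hadamard transform conjugates `Z` to `X`.
  let H : Matrix (Fin 2) (Fin 2) ℂ := !![1, 1; 1, -1]
  have hH : H * ((1 / 2 : ℂ) • H) = 1 := by
    ext i j
    fin_cases i <;> fin_cases j <;> simp [H, Matrix.mul_apply, Fin.sum_univ_two] <;> norm_num
  have hinv : H⁻¹ = (1 / 2 : ℂ) • H := inv_eq_right_inv hH
  have hu : IsUnit H := IsUnit.of_mul_eq_one _ hH
  have h : (-(Complex.I * (t : ℂ) / 2)) • pauliX =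
      H * ((-(Complex.I * (t : ℂ) / 2)) • pauliZ) * H⁻¹ := by
    rw [hinv]
    ext i j
    fin_cases i <;> fin_cases j <;>
      simp [H, pauliX, pauliZ, Matrix.mul_apply, Fin.sum_univ_two] <;> ring
  have hZ := RZ_eq t
  rw [RZ] at hZ
  rw [RX, h, exp_conj _ _ hu, hZ, hinv]
  ext i j
  fin_cases i <;> fin_cases j <;> simp [H, Matrix.mul_apply, Fin.sum_univ_two] <;> ring

/-- The coordinates of the Hermitian matrix `w I + x X + y Y + z Z` in the Pauli basis. -/
@[ext]
structure PauliVec where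
  /-- the coefficient of the identity -/
  w : ℝ
  /-- the coefficient of `X` -/
  x : ℝ
  /-- the coefficient of `Y` -/
  y : ℝ
  /-- the coefficient of `Z` -/
  z : ℝ

namespace PauliVec

/-- The one-qubit observable `w I + x X + y Y + z Z`. -/
def toMatrix (v : PauliVec) : Matrix (Fin 2) (Fin 2) ℂ :=
  !![(v.w : ℂ) + v.z, v.x - Complex.I * v.y; v.x + Complex.I * v.y, v.w - v.z]

/-- Heisenberg evolution of an observable under `R_Z(t)`. -/
noncomputable def rotZ (t : ℝ) (v : PauliVec) : PauliVec :=
  ⟨v.w, v.x * Real.cos t + v.y * Real.sin t, v.y * Real.cos t - v.x * Real.sin t, v.z⟩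

/-- Heisenberg evolution of an observable under `R_X(t)`. -/
noncomputable def rotX (t : ℝ) (v : PauliVec) : PauliVec :=
  ⟨v.w, v.x, v.y * Real.cos t + v.z * Real.sin t, v.z * Real.cos t - v.y * Real.sin t⟩

/-- Heisenberg evolution of an observable under `R_X(s)` followed by `R_Z(t)`. -/
noncomputable def rot (s t : ℝ) (v : PauliVec) : PauliVec := rotX s (rotZ t v)

end PauliVec

/-- Double-angle formulas for `t`, in terms of the half angle that occurs in the rotation gates. -/
theorem half_angle (t : ℝ) :
    (Real.cos t : ℂ) = Complex.cos (t / 2) ^ 2 - Complex.sin (t / 2) ^ 2 ∧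
      (Real.sin t : ℂ) = 2 * Complex.sin (t / 2) * Complex.cos (t / 2) ∧
      Complex.sin (t / 2) ^ 2 + Complex.cos (t / 2) ^ 2 = 1 ∧
      (starRingEnd ℂ) (Complex.cos (t / 2)) = Complex.cos (t / 2) ∧
      (starRingEnd ℂ) (Complex.sin (t / 2)) = Complex.sin (t / 2) := by
  refine ⟨?_, ?_, Complex.sin_sq_add_cos_sq _, ?_, ?_⟩
  · rw [Complex.ofReal_cos, ← Complex.cos_two_mul', mul_div_cancel₀ _ two_ne_zero]
  · rw [Complex.ofReal_sin, ← Complex.sin_two_mul, mul_div_cancel₀ _ two_ne_zero]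
  · rw [← Complex.cos_conj, map_div₀, Complex.conj_ofReal, map_ofNat]
  · rw [← Complex.sin_conj, map_div₀, Complex.conj_ofReal, map_ofNat]

theorem conjTranspose_RZ_mul_mul (t : ℝ) (v : PauliVec) :
    (RZ t)ᴴ * v.toMatrix * RZ t = (v.rotZ t).toMatrix := by
  obtain ⟨hc, hs, h1, hcc, hss⟩ := half_angle t
  rw [RZ_eq]
  generalize Complex.cos (t / 2 : ℂ) = c at *
  generalize Complex.sin (t / 2 : ℂ) = s at *
  have hI := Complex.I_sq
  ext i j
  fin_cases i <;> fin_cases j <;>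
    simp [PauliVec.toMatrix, PauliVec.rotZ, Matrix.mul_apply, Fin.sum_univ_two, hcc, hss,
      -Complex.ofReal_cos, -Complex.ofReal_sin, hc, hs] <;> grind

theorem conjTranspose_RX_mul_mul (t : ℝ) (v : PauliVec) :
    (RX t)ᴴ * v.toMatrix * RX t = (v.rotX t).toMatrix := by
  obtain ⟨hc, hs, h1, hcc, hss⟩ := half_angle t
  rw [RX_eq]
  generalize Complex.cos (t / 2 : ℂ) = c at *
  generalize Complex.sin (t / 2 : ℂ) = s at *
  have hI := Complex.I_sq
  ext i j
  fin_cases i <;> fin_cases j <;>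
    simp [PauliVec.toMatrix, PauliVec.rotX, Matrix.mul_apply, Fin.sum_univ_two, hcc, hss,
      -Complex.ofReal_cos, -Complex.ofReal_sin, hc, hs] <;> grind

theorem conjTranspose_RZ_mul_RX_mul_mul (s t : ℝ) (v : PauliVec) :
    (RZ t * RX s)ᴴ * v.toMatrix * (RZ t * RX s) = (v.rot s t).toMatrix := by
  rw [PauliVec.rot, ← conjTranspose_RX_mul_mul, ← conjTranspose_RZ_mul_mul, conjTranspose_mul]
  simp only [Matrix.mul_assoc]

theorem toMatrix_identity : (⟨1, 0, 0, 0⟩ : PauliVec).toMatrix = 1 := by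
  ext i j
  fin_cases i <;> fin_cases j <;> simp [PauliVec.toMatrix]

theorem pauliX_eq_toMatrix : pauliX = (⟨0, 1, 0, 0⟩ : PauliVec).toMatrix := by
  ext i j
  fin_cases i <;> fin_cases j <;> simp [pauliX, PauliVec.toMatrix]

theorem RZ_mem_unitary (t : ℝ) : RZ t ∈ unitary (Matrix (Fin 2) (Fin 2) ℂ) := by
  have h : (RZ t)ᴴ * RZ t = 1 := by
    have := conjTranspose_RZ_mul_mul t ⟨1, 0, 0, 0⟩
    simpa [PauliVec.rotZ, toMatrix_identity] using this
  exact ⟨h, mul_eq_one_comm.mp h⟩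

theorem RX_mem_unitary (t : ℝ) : RX t ∈ unitary (Matrix (Fin 2) (Fin 2) ℂ) := by
  have h : (RX t)ᴴ * RX t = 1 := by
    have := conjTranspose_RX_mul_mul t ⟨1, 0, 0, 0⟩
    simpa [PauliVec.rotX, toMatrix_identity] using this
  exact ⟨h, mul_eq_one_comm.mp h⟩

end QTTN

/-! ### One-qubit operators and the `CNOT` gate on a register -/

namespace QTTN
open Matrix

section Operators

variable {Q : Type} [Fintype Q] [DecidableEq Q]

theorem onQubit_mulVec (q : Q) (A : Matrix (Fin 2) (Fin 2) ℂ) (ψ : (Q → Fin 2) → ℂ)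
    (b : Q → Fin 2) :
    (onQubit q A *ᵥ ψ) b = ∑ s, A (b q) s * ψ (Function.update b q s) := by
  have hinj : Function.Injective (fun s : Fin 2 => Function.update b q s) :=
    Function.update_injective b q
  have himg : ∑ s, A (b q) s * ψ (Function.update b q s) =
      ∑ b' ∈ Finset.univ.image (fun s : Fin 2 => Function.update b q s),
        A (b q) (b' q) * ψ b' := by
    rw [Finset.sum_image fun _ _ _ _ h => hinj h]
    simp
  rw [himg, mulVec, dotProduct]
  symm
  apply Finset.sum_subset_zero_on_sdiff (Finset.subset_univ _)
  · intro b' hb'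
    have hne : ¬ ∀ r, r ≠ q → b r = b' r := by
      intro h
      refine (Finset.mem_sdiff.mp hb').2 (Finset.mem_image.mpr ⟨b' q, Finset.mem_univ _, ?_⟩)
      ext r : 1
      by_cases hr : r = q
      · subst hr; simp
      · simp [hr, h r hr]
    simp [onQubit, hne]
  · intro b' hb'
    obtain ⟨s, -, rfl⟩ := Finset.mem_image.mp hb'
    have : ∀ r, r ≠ q → b r = Function.update b q s r := fun r hr => by simp [hr]
    simp only [onQubit]
    rw [if_pos this]

theorem onQubit_mul (q : Q) (A B : Matrix (Fin 2) (Fin 2) ℂ) :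
    onQubit q A * onQubit q B = onQubit q (A * B) := by
  refine ext_iff_mulVec.mpr fun ψ => ?_
  ext b
  rw [← mulVec_mulVec]
  simp only [onQubit_mulVec, Fin.sum_univ_two, Function.update_self, Function.update_idem,
    Matrix.mul_apply]
  ring

theorem onQubit_one (q : Q) : onQubit q (1 : Matrix (Fin 2) (Fin 2) ℂ) = 1 := by
  refine ext_iff_mulVec.mpr fun ψ => ?_
  ext b
  rw [onQubit_mulVec, one_mulVec, Finset.sum_eq_single (b q)]
  · simp
  · intro s _ hs
    simp [one_apply_ne hs.symm]
  · simp

theorem onQubit_add (q : Q) (A B : Matrix (Fin 2) (Fin 2) ℂ) :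
    onQubit q (A + B) = onQubit q A + onQubit q B := by
  ext b b'
  simp only [onQubit, Matrix.add_apply]
  split_ifs <;> simp

theorem onQubit_smul (q : Q) (c : ℂ) (A : Matrix (Fin 2) (Fin 2) ℂ) :
    onQubit q (c • A) = c • onQubit q A := by
  ext b b'
  simp only [onQubit, Matrix.smul_apply]
  split_ifs <;> simp

theorem conjTranspose_onQubit (q : Q) (A : Matrix (Fin 2) (Fin 2) ℂ) :
    (onQubit q A)ᴴ = onQubit q Aᴴ := by
  ext b b'
  simp only [onQubit, conjTranspose_apply, eq_comm (a := b' _)]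
  split_ifs <;> simp

theorem onQubit_commute {q r : Q} (h : q ≠ r) (A B : Matrix (Fin 2) (Fin 2) ℂ) :
    Commute (onQubit q A) (onQubit r B) := by
  refine ext_iff_mulVec.mpr fun ψ => ?_
  ext b
  rw [← mulVec_mulVec, ← mulVec_mulVec]
  simp only [onQubit_mulVec, Fin.sum_univ_two, Function.update_of_ne h,
    Function.update_of_ne h.symm,
    Function.update_comm h]
  ring

/-- The projection onto `|0⟩`. -/
def proj0 : Matrix (Fin 2) (Fin 2) ℂ := !![1, 0; 0, 0]

/-- The projection onto `|1⟩`. -/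
def proj1 : Matrix (Fin 2) (Fin 2) ℂ := !![0, 0; 0, 1]

theorem conjTranspose_proj0 : proj0ᴴ = proj0 := by
  ext i j
  fin_cases i <;> fin_cases j <;> simp [proj0]

theorem conjTranspose_proj1 : proj1ᴴ = proj1 := by
  ext i j
  fin_cases i <;> fin_cases j <;> simp [proj1]

theorem conjTranspose_pauliX : pauliXᴴ = pauliX := by
  ext i j
  fin_cases i <;> fin_cases j <;> simp [pauliX]

/-- The `CNOT` gate as an element of the algebra generated by the one-qubit operators. -/
theorem cnot_eq {c t : Q} (h : c ≠ t) :
    cnot c t = onQubit c proj0 + onQubit c proj1 * onQubit t pauliX := by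
  refine ext_iff_mulVec.mpr fun ψ => ?_
  ext b
  have key : (cnot c t *ᵥ ψ) b = ψ (Function.update b t (b t + b c)) := by
    -- Adding the control bit to the target bit is an involution.
    have hiff : ∀ b' : Q → Fin 2, b = Function.update b' t (b' t + b' c) ↔
        b' = Function.update b t (b t + b c) := by
      have h2 : ∀ x y : Fin 2, x + y + y = x := by decide
      intro b'
      constructor
      · rintro rfl
        simp [Function.update_of_ne h, h2]
      · rintro rfl
        simp [Function.update_of_ne h, h2]
    rw [mulVec, dotProduct, Finset.sum_eq_single (Function.update b t (b t + b c))]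
    · rw [cnot, if_pos ((hiff _).mpr rfl), one_mul]
    · intro b' _ hb'
      rw [cnot, if_neg (fun hb => hb' ((hiff b').mp hb)), zero_mul]
    · simp
  rw [key, add_mulVec, ← mulVec_mulVec, Pi.add_apply]
  simp only [onQubit_mulVec, Fin.sum_univ_two, Function.update_of_ne h.symm]
  have hc : ∀ x : Fin 2, x = 0 ∨ x = 1 := by decide
  have hsc := Function.update_eq_self c b
  have hst := Function.update_eq_self t b
  rcases hc (b c) with hbc | hbc <;> rcases hc (b t) with hbt | hbt <;>
    rw [hbc] at hsc <;> rw [hbt] at hst <;>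
    simp [hbc, hbt, proj0, proj1, pauliX, hsc, hst]

theorem onQubit_mem_unitary (q : Q) {A : Matrix (Fin 2) (Fin 2) ℂ}
    (hA : A ∈ unitary (Matrix (Fin 2) (Fin 2) ℂ)) : onQubit q A ∈ unitary (Op Q) := by
  have h1 : Aᴴ * A = 1 := hA.1
  have h : (onQubit q A)ᴴ * onQubit q A = 1 := by
    rw [conjTranspose_onQubit, onQubit_mul, h1, onQubit_one]
  exact ⟨h, mul_eq_one_comm.mp h⟩

theorem onQubit_commute_cnot {q c t : Q} (hct : c ≠ t) (hc : q ≠ c) (ht : q ≠ t)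
    (A : Matrix (Fin 2) (Fin 2) ℂ) : Commute (onQubit q A) (cnot c t) := by
  rw [cnot_eq hct]
  exact (onQubit_commute hc _ _).add_right
    ((onQubit_commute hc _ _).mul_right (onQubit_commute ht _ _))

/-- Heisenberg evolution through `CNOT` of an observable on the control qubit: its diagonal part
is unchanged, and its off-diagonal part picks up an `X` on the target. -/
theorem cnot_conj_control {c t : Q} (h : c ≠ t) (E : Matrix (Fin 2) (Fin 2) ℂ) :
    (cnot c t)ᴴ * onQubit c E * cnot c t =
      onQubit c (proj0 * E * proj0 + proj1 * E * proj1) +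
        onQubit c (proj0 * E * proj1 + proj1 * E * proj0) * onQubit t pauliX := by
  have hX : onQubit t pauliX * onQubit t pauliX = 1 := by
    rw [onQubit_mul, ← onQubit_one t]
    congr 1
    ext i j
    fin_cases i <;> fin_cases j <;> simp [pauliX]
  have hp1 := (onQubit_commute h proj1 pauliX).eq
  have hp0 := (onQubit_commute h proj0 pauliX).eq
  have hE := (onQubit_commute h E pauliX).eq
  rw [cnot_eq h, conjTranspose_add, conjTranspose_mul]
  simp only [conjTranspose_onQubit, conjTranspose_proj0, conjTranspose_proj1,
    conjTranspose_pauliX, onQubit_add, ← onQubit_mul]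
  generalize onQubit c proj0 = p0 at *
  generalize onQubit c proj1 = p1 at *
  generalize onQubit t pauliX = X at *
  generalize onQubit c E = E at *
  have e1 : X * p1 * E * (p1 * X) = p1 * E * p1 := by
    rw [← hp1, mul_assoc p1, ← hE, hp1]
    calc p1 * (E * X) * (X * p1) = p1 * E * (X * X) * p1 := by simp only [mul_assoc]
      _ = p1 * E * p1 := by rw [hX, mul_one]
  have e2 : X * p1 * E * p0 = p1 * E * p0 * X := by
    rw [← hp1, mul_assoc p1, ← hE]
    simp only [mul_assoc, hp0]
  rw [← mul_assoc] at e1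
  simp only [add_mul, mul_add, e2, ← mul_assoc, e1]
  abel

/-- Heisenberg evolution through `CNOT` of an observable on the target qubit. -/
theorem cnot_conj_target {c t : Q} (h : c ≠ t) (E : Matrix (Fin 2) (Fin 2) ℂ) :
    (cnot c t)ᴴ * onQubit t E * cnot c t =
      onQubit c proj0 * onQubit t E + onQubit c proj1 * onQubit t (pauliX * E * pauliX) := by
  have h00 : onQubit c proj0 * onQubit c proj0 = onQubit c proj0 := by
    rw [onQubit_mul]; congr 1; ext i j; fin_cases i <;> fin_cases j <;> simp [proj0]
  have h11 : onQubit c proj1 * onQubit c proj1 = onQubit c proj1 := by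
    rw [onQubit_mul]; congr 1; ext i j; fin_cases i <;> fin_cases j <;> simp [proj1]
  have hz : onQubit c (0 : Matrix (Fin 2) (Fin 2) ℂ) = 0 := by
    simpa using onQubit_smul c 0 (0 : Matrix (Fin 2) (Fin 2) ℂ)
  have h01 : onQubit c proj0 * onQubit c proj1 = 0 := by
    rw [onQubit_mul, ← hz]; congr 1; ext i j; fin_cases i <;> fin_cases j <;> simp [proj0, proj1]
  have h10 : onQubit c proj1 * onQubit c proj0 = 0 := by
    rw [onQubit_mul, ← hz]; congr 1; ext i j; fin_cases i <;> fin_cases j <;> simp [proj0, proj1]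
  have hX1 := (onQubit_commute h proj1 pauliX).eq
  have hE0 := (onQubit_commute h proj0 E).eq
  have hE1 := (onQubit_commute h proj1 E).eq
  rw [cnot_eq h, conjTranspose_add, conjTranspose_mul]
  simp only [conjTranspose_onQubit, conjTranspose_proj0, conjTranspose_proj1,
    conjTranspose_pauliX, ← onQubit_mul]
  generalize onQubit c proj0 = p0 at *
  generalize onQubit c proj1 = p1 at *
  generalize onQubit t pauliX = X at *
  generalize onQubit t E = E at *
  have e1 : p0 * E * p0 = p0 * E := by rw [mul_assoc, ← hE0, ← mul_assoc, h00]
  have e2 : p0 * E * (p1 * X) = 0 := by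
    rw [hE0, mul_assoc, ← mul_assoc p0, h01, zero_mul, mul_zero]
  have e3 : X * p1 * E * p0 = 0 := by
    rw [mul_assoc _ E, ← hE0, ← mul_assoc, mul_assoc X, h10, mul_zero, zero_mul]
  have e4 : X * p1 * E * (p1 * X) = p1 * (X * E * X) := by
    rw [mul_assoc X, hE1, mul_assoc X, mul_assoc E, ← mul_assoc p1, h11, ← mul_assoc E, ← hE1]
    simp only [← mul_assoc, hX1]
  simp only [add_mul, mul_add, e1, e2, e3, e4, add_zero, zero_add]

/-- The value `⟨ψ| H |ψ⟩` of the quadratic form of `H`. -/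
def quadForm (ψ : (Q → Fin 2) → ℂ) (H : Op Q) : ℂ := star ψ ⬝ᵥ H *ᵥ ψ

theorem quadForm_mulVec (ψ : (Q → Fin 2) → ℂ) (U H : Op Q) :
    quadForm (U *ᵥ ψ) H = quadForm ψ (Uᴴ * H * U) := by
  simp only [quadForm, star_mulVec, dotProduct_mulVec, vecMul_vecMul, Matrix.mul_assoc]

theorem quadForm_add (ψ : (Q → Fin 2) → ℂ) (H K : Op Q) :
    quadForm ψ (H + K) = quadForm ψ H + quadForm ψ K := by
  simp [quadForm, add_mulVec]

theorem quadForm_smul (ψ : (Q → Fin 2) → ℂ) (c : ℂ) (H : Op Q) :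
    quadForm ψ (c • H) = c * quadForm ψ H := by
  simp [quadForm, smul_mulVec]

/-- Conjugation by a unitary that commutes with the observable has no effect. -/
theorem quadForm_mulVec_of_commute (ψ : (Q → Fin 2) → ℂ) {U H : Op Q}
    (hU : U ∈ unitary (Op Q)) (hc : Commute H U) : quadForm (U *ᵥ ψ) H = quadForm ψ H := by
  have h1 : Uᴴ * U = 1 := hU.1
  rw [quadForm_mulVec, Matrix.mul_assoc, hc.eq, ← Matrix.mul_assoc, h1, Matrix.one_mul]

/-- Qubit `q` of `ψ` is in the state `|0⟩`: the projection onto `|0⟩` on `q` fixes `ψ`. -/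
def IsClean (q : Q) (ψ : (Q → Fin 2) → ℂ) : Prop := onQubit q proj0 *ᵥ ψ = ψ

theorem IsClean.mulVec_of_commute {q : Q} {ψ : (Q → Fin 2) → ℂ} (h : IsClean q ψ) {U : Op Q}
    (hU : Commute (onQubit q proj0) U) : IsClean q (U *ᵥ ψ) := by
  rw [IsClean, mulVec_mulVec, hU.eq, ← mulVec_mulVec, h]

/-- An observable on a clean qubit may be replaced by its expectation in the state `|0⟩`. -/
theorem quadForm_onQubit_mul_onQubit {a b : Q} (hab : a ≠ b) {ψ : (Q → Fin 2) → ℂ}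
    (h : IsClean b ψ) (A B : Matrix (Fin 2) (Fin 2) ℂ) :
    quadForm ψ (onQubit a A * onQubit b B) = B 0 0 * quadForm ψ (onQubit a A) := by
  have hB : proj0 * B * proj0 = B 0 0 • proj0 := by
    ext i j
    fin_cases i <;> fin_cases j <;>
      simp [proj0, Matrix.mul_apply, Fin.sum_univ_two, vecMul, dotProduct]
  calc quadForm ψ (onQubit a A * onQubit b B)
      = quadForm (onQubit b proj0 *ᵥ ψ) (onQubit a A * onQubit b B) := by rw [h]
    _ = quadForm ψ (onQubit a A * onQubit b (proj0 * B * proj0)) := by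
        rw [quadForm_mulVec, conjTranspose_onQubit, conjTranspose_proj0, ← Matrix.mul_assoc,
          ← (onQubit_commute hab A proj0).eq, Matrix.mul_assoc, Matrix.mul_assoc, onQubit_mul,
          onQubit_mul, Matrix.mul_assoc]
    _ = B 0 0 * quadForm ψ (onQubit a A * onQubit b proj0) := by
        rw [hB, onQubit_smul, Matrix.mul_smul, quadForm_smul]
    _ = B 0 0 * quadForm ψ (onQubit a A) := by
        congr 1
        rw [quadForm, ← mulVec_mulVec, h, quadForm]

end Operators

end QTTN

/-! ### The effective observable on the first qubit -/

namespace QTTN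
open Matrix

namespace PauliVec

/-- One recursion step for an observable on the upper half.  Seen through the `CNOT`, whose
target enters in the state `R_Z(b₁) R_X(b₀) |0⟩`, the off-diagonal part of the observable on the
control is scaled by the expectation `sin b₀ sin b₁` of `X` on the target. -/
noncomputable def upperStep (a₀ a₁ b₀ b₁ : ℝ) (v : PauliVec) : PauliVec :=
  rot a₀ a₁ ⟨v.w, Real.sin b₀ * (Real.sin b₁ * v.x), Real.sin b₀ * (Real.sin b₁ * v.y), v.z⟩

/-- One recursion step for an observable on the lower half.  Seen through the `CNOT`, the
observable on the target becomes diagonal on the control. -/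
noncomputable def lowerStep (a₀ a₁ b₀ b₁ : ℝ) (v : PauliVec) : PauliVec :=
  rot a₀ a₁ ⟨v.w + Real.sin b₀ * Real.sin b₁ * v.x, 0, 0,
    v.z * Real.cos b₀ + -(v.y * Real.cos b₁) * Real.sin b₀⟩

end PauliVec

/-- The label of the `R_Z` parameter of the one-qubit circuit. -/
def baseParamZ : Param 0 := (1 : Fin 2)

/-- The labels of the parameters of the top recursion level. -/
def topParam (n : ℕ) (p : Fin 2 × Fin 2) : Param (n + 1) := Sum.inl p

/-- The labels of the parameters of the upper half. -/
def upperParam (n : ℕ) (p : Param n) : Param (n + 1) := Sum.inr (Sum.inl p)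

/-- The labels of the parameters of the lower half. -/
def lowerParam (n : ℕ) (p : Param n) : Param (n + 1) := Sum.inr (Sum.inr p)

/-- The effective observable of `X_i`: the observable on the first qubit of the register which
has, in the input state, the same expectation as `X_i` in the output state of the circuit, provided
that all the other qubits enter in the state `|0⟩`. -/
noncomputable def pauliObs : ∀ n : ℕ, Fin (2 ^ n) → (Param n → ℝ) → PauliVec
  | 0, _, θ => PauliVec.rot (θ (param11 0)) (θ baseParamZ) ⟨0, 1, 0, 0⟩
  | n + 1, i, θ =>
    if h : (i : ℕ) < 2 ^ n then
      PauliVec.upperStep (θ (topParam n (0, 0))) (θ (topParam n (0, 1))) (θ (topParam n (1, 0)))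
        (θ (topParam n (1, 1))) (pauliObs n ⟨i, h⟩ fun p => θ (upperParam n p))
    else
      PauliVec.lowerStep (θ (topParam n (0, 0))) (θ (topParam n (0, 1))) (θ (topParam n (1, 0)))
        (θ (topParam n (1, 1)))
        (pauliObs n ⟨i - 2 ^ n, by have := i.isLt.trans_eq (pow_succ 2 n); omega⟩
          fun p => θ (lowerParam n p))

theorem pauliObs_upper (n : ℕ) (i : Fin (2 ^ n)) (θ : Param (n + 1) → ℝ) :
    pauliObs (n + 1) (upper n i) θ =
      PauliVec.upperStep (θ (topParam n (0, 0))) (θ (topParam n (0, 1))) (θ (topParam n (1, 0)))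
        (θ (topParam n (1, 1))) (pauliObs n i fun p => θ (upperParam n p)) := by
  have h : ((upper n i : Fin (2 ^ (n + 1))) : ℕ) < 2 ^ n := i.isLt
  rw [pauliObs, dif_pos h]
  rfl

theorem pauliObs_lower (n : ℕ) (i : Fin (2 ^ n)) (θ : Param (n + 1) → ℝ) :
    pauliObs (n + 1) (lower n i) θ =
      PauliVec.lowerStep (θ (topParam n (0, 0))) (θ (topParam n (0, 1))) (θ (topParam n (1, 0)))
        (θ (topParam n (1, 1))) (pauliObs n i fun p => θ (lowerParam n p)) := by
  have h : ¬ ((lower n i : Fin (2 ^ (n + 1))) : ℕ) < 2 ^ n := by simp [lower]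
  rw [pauliObs, dif_neg h]
  congr 2
  ext
  simp [lower]

theorem upper_injective (n : ℕ) : Function.Injective (upper n) := fun i j h => by
  simpa [upper, Fin.ext_iff] using h

theorem lower_injective (n : ℕ) : Function.Injective (lower n) := fun i j h => by
  simpa [lower, Fin.ext_iff] using h

theorem upper_ne_lower (n : ℕ) (i j : Fin (2 ^ n)) : upper n i ≠ lower n j := by
  have := i.isLt
  simp only [upper, lower, ne_eq, Fin.ext_iff]
  omega

theorem upper_firstQubit (n : ℕ) : upper n (firstQubit n) = firstQubit (n + 1) := rfl

theorem lower_lastQubit (n : ℕ) : lower n (lastQubit n) = lastQubit (n + 1) := by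
  have : 0 < 2 ^ n := by positivity
  simp only [lower, lastQubit, Fin.ext_iff, pow_succ]
  omega

/-- Every qubit lies in the upper or in the lower half. -/
theorem exists_upper_or_lower (n : ℕ) (i : Fin (2 ^ (n + 1))) :
    (∃ j, i = upper n j) ∨ ∃ j, i = lower n j := by
  have hi := i.isLt.trans_eq (pow_succ 2 n)
  by_cases h : (i : ℕ) < 2 ^ n
  · exact Or.inl ⟨⟨i, h⟩, rfl⟩
  · refine Or.inr ⟨⟨i - 2 ^ n, by omega⟩, ?_⟩
    simp only [lower, Fin.ext_iff]
    omega

section Circuit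

variable {Q : Type} [Fintype Q] [DecidableEq Q]

theorem onQubit_commute_circuitOn : ∀ (n : ℕ) (e : Fin (2 ^ n) → Q), Function.Injective e →
    ∀ (θ : Param n → ℝ) {q : Q}, (∀ j, e j ≠ q) → ∀ A : Matrix (Fin 2) (Fin 2) ℂ,
      Commute (onQubit q A) (circuitOn n e θ)
  | 0, e, _, θ, q, hq, A => by
    have h := (hq (firstQubit 0)).symm
    exact (onQubit_commute h _ _).mul_right (onQubit_commute h _ _)
  | n + 1, e, he, θ, q, hq, A => by
    have ha := (hq (upper n (firstQubit n))).symm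
    have hb := (hq (lower n (firstQubit n))).symm
    have hab : e (upper n (firstQubit n)) ≠ e (lower n (firstQubit n)) :=
      he.ne (upper_ne_lower n _ _)
    have hl := onQubit_commute_circuitOn n (e ∘ lower n) (he.comp (lower_injective n))
      (fun p => θ (lowerParam n p)) (q := q) (fun j => hq _) A
    have hu := onQubit_commute_circuitOn n (e ∘ upper n) (he.comp (upper_injective n))
      (fun p => θ (upperParam n p)) (q := q) (fun j => hq _) A
    exact (((hl.mul_right hu).mul_right (onQubit_commute_cnot hab ha hb A)).mul_right
      ((onQubit_commute hb _ _).mul_right (onQubit_commute ha _ _))).mul_right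
      ((onQubit_commute hb _ _).mul_right (onQubit_commute ha _ _))

theorem cnot_mem_unitary {c t : Q} (h : c ≠ t) : cnot c t ∈ unitary (Op Q) := by
  have h1 : (cnot c t)ᴴ * cnot c t = 1 := by
    have := cnot_conj_control h 1
    rw [onQubit_one, Matrix.mul_one] at this
    have e1 : proj0 * 1 * proj0 + proj1 * 1 * proj1 = 1 := by
      ext i j; fin_cases i <;> fin_cases j <;> simp [proj0, proj1]
    have e2 : proj0 * 1 * proj1 + proj1 * 1 * proj0 = (0 : ℂ) • 1 := by
      ext i j; fin_cases i <;> fin_cases j <;> simp [proj0, proj1]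
    rw [this, e1, e2, onQubit_smul, zero_smul, Matrix.zero_mul, add_zero, onQubit_one]
  exact ⟨h1, mul_eq_one_comm.mp h1⟩

/-- The placed circuit is unitary; the placement has to be injective for the `CNOT` gates to act
on distinct qubits. -/
theorem circuitOn_mem_unitary : ∀ (n : ℕ) (e : Fin (2 ^ n) → Q), Function.Injective e →
    ∀ θ : Param n → ℝ, circuitOn n e θ ∈ unitary (Op Q)
  | 0, e, _, θ =>
    mul_mem (onQubit_mem_unitary _ (RZ_mem_unitary _)) (onQubit_mem_unitary _ (RX_mem_unitary _))
  | n + 1, e, he, θ => by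
    have hab : e (upper n (firstQubit n)) ≠ e (lower n (firstQubit n)) :=
      he.ne (upper_ne_lower n _ _)
    exact mul_mem (mul_mem (mul_mem (mul_mem
      (circuitOn_mem_unitary n _ (he.comp (lower_injective n)) _)
      (circuitOn_mem_unitary n _ (he.comp (upper_injective n)) _)) (cnot_mem_unitary hab))
      (mul_mem (onQubit_mem_unitary _ (RZ_mem_unitary _))
        (onQubit_mem_unitary _ (RZ_mem_unitary _))))
      (mul_mem (onQubit_mem_unitary _ (RX_mem_unitary _))
        (onQubit_mem_unitary _ (RX_mem_unitary _)))

/-- The gates of the top recursion level, on the first qubits `a` and `b` of the two halves. -/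
noncomputable def topLayer (a b : Q) (a₀ a₁ b₀ b₁ : ℝ) : Op Q :=
  cnot a b * (onQubit b (RZ b₁) * onQubit a (RZ a₁)) * (onQubit b (RX b₀) * onQubit a (RX a₀))

theorem topLayer_eq {a b : Q} (hab : a ≠ b) (a₀ a₁ b₀ b₁ : ℝ) :
    topLayer a b a₀ a₁ b₀ b₁ =
      cnot a b * (onQubit b (RZ b₁ * RX b₀) * onQubit a (RZ a₁ * RX a₀)) := by
  have h := (onQubit_commute hab (RZ a₁) (RX b₀)).eq
  rw [topLayer, ← onQubit_mul, ← onQubit_mul, Matrix.mul_assoc,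
    Matrix.mul_assoc (onQubit b (RZ b₁)),
    ← Matrix.mul_assoc (onQubit a (RZ a₁)), h]
  simp only [Matrix.mul_assoc]

theorem onQubit_conj_onQubit_mul_onQubit {a b : Q} (hab : a ≠ b)
    (R S A B : Matrix (Fin 2) (Fin 2) ℂ) :
    (onQubit b S * onQubit a R)ᴴ * (onQubit a A * onQubit b B) * (onQubit b S * onQubit a R) =
      onQubit a (Rᴴ * A * R) * onQubit b (Sᴴ * B * S) := by
  have h1 := (onQubit_commute hab A Sᴴ).eq
  have h2 := (onQubit_commute hab R (Sᴴ * (B * S))).eq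
  simp only [conjTranspose_mul, conjTranspose_onQubit, Matrix.mul_assoc, ← onQubit_mul] at h2 ⊢
  rw [h2, ← Matrix.mul_assoc (onQubit b Sᴴ) (onQubit a A), ← h1]
  simp only [Matrix.mul_assoc]

/-- Expectations of an observable on the control qubit, pulled back through the top layer. -/
theorem quadForm_topLayer_control {a b : Q} (hab : a ≠ b) {ψ : (Q → Fin 2) → ℂ}
    (hψ : IsClean b ψ) (a₀ a₁ b₀ b₁ : ℝ) (v : PauliVec) :
    quadForm (topLayer a b a₀ a₁ b₀ b₁ *ᵥ ψ) (onQubit a v.toMatrix) =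
      quadForm ψ (onQubit a (v.upperStep a₀ a₁ b₀ b₁).toMatrix) := by
  have hD : proj0 * v.toMatrix * proj0 + proj1 * v.toMatrix * proj1 =
      (⟨v.w, 0, 0, v.z⟩ : PauliVec).toMatrix := by
    ext i j; fin_cases i <;> fin_cases j <;> simp [proj0, proj1, PauliVec.toMatrix]
  have hF : proj0 * v.toMatrix * proj1 + proj1 * v.toMatrix * proj0 =
      (⟨0, v.x, v.y, 0⟩ : PauliVec).toMatrix := by
    ext i j; fin_cases i <;> fin_cases j <;> simp [proj0, proj1, PauliVec.toMatrix]
  -- The diagonal part is written as a product with the identity on `b`, so that the same two lemmas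
  -- pull both parts back through the rotations and evaluate the factor on `b` in the state `|0⟩`.
  rw [topLayer_eq hab, ← mulVec_mulVec, quadForm_mulVec, cnot_conj_control hab, hD, hF,
    quadForm_add,
    ← Matrix.mul_one (onQubit a (PauliVec.toMatrix ⟨v.w, 0, 0, v.z⟩)), ← onQubit_one b,
    quadForm_mulVec, quadForm_mulVec, onQubit_conj_onQubit_mul_onQubit hab,
    onQubit_conj_onQubit_mul_onQubit hab, quadForm_onQubit_mul_onQubit hab hψ,
    quadForm_onQubit_mul_onQubit hab hψ, ← toMatrix_identity, pauliX_eq_toMatrix]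
  simp only [conjTranspose_RZ_mul_RX_mul_mul]
  rw [← quadForm_smul, ← quadForm_smul, ← quadForm_add, ← onQubit_smul, ← onQubit_smul,
    ← onQubit_add]
  congr 2
  ext i j
  fin_cases i <;> fin_cases j <;>
    simp [PauliVec.toMatrix, PauliVec.upperStep, PauliVec.rot, PauliVec.rotX, PauliVec.rotZ] <;>
    ring

/-- Expectations of an observable on the target qubit, pulled back through the top layer. -/
theorem quadForm_topLayer_target {a b : Q} (hab : a ≠ b) {ψ : (Q → Fin 2) → ℂ}
    (hψ : IsClean b ψ) (a₀ a₁ b₀ b₁ : ℝ) (v : PauliVec) :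
    quadForm (topLayer a b a₀ a₁ b₀ b₁ *ᵥ ψ) (onQubit b v.toMatrix) =
      quadForm ψ (onQubit a (v.lowerStep a₀ a₁ b₀ b₁).toMatrix) := by
  have h0 : proj0 = (⟨1 / 2, 0, 0, 1 / 2⟩ : PauliVec).toMatrix := by
    ext i j; fin_cases i <;> fin_cases j <;> simp [proj0, PauliVec.toMatrix] <;> norm_num
  have h1 : proj1 = (⟨1 / 2, 0, 0, -1 / 2⟩ : PauliVec).toMatrix := by
    ext i j; fin_cases i <;> fin_cases j <;> simp [proj1, PauliVec.toMatrix] <;> norm_num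
  have hX : pauliX * v.toMatrix * pauliX = (⟨v.w, v.x, -v.y, -v.z⟩ : PauliVec).toMatrix := by
    ext i j
    fin_cases i <;> fin_cases j <;> simp [pauliX, PauliVec.toMatrix, Matrix.mul_apply,
      Fin.sum_univ_two, sub_eq_add_neg]
  rw [topLayer_eq hab, ← mulVec_mulVec, quadForm_mulVec, cnot_conj_target hab, hX, quadForm_add,
    quadForm_mulVec, quadForm_mulVec, onQubit_conj_onQubit_mul_onQubit hab,
    onQubit_conj_onQubit_mul_onQubit hab, quadForm_onQubit_mul_onQubit hab hψ,
    quadForm_onQubit_mul_onQubit hab hψ, h0, h1]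
  simp only [conjTranspose_RZ_mul_RX_mul_mul]
  rw [← quadForm_smul, ← quadForm_smul, ← quadForm_add, ← onQubit_smul, ← onQubit_smul,
    ← onQubit_add]
  congr 2
  ext i j
  fin_cases i <;> fin_cases j <;>
    simp [PauliVec.toMatrix, PauliVec.lowerStep, PauliVec.rot, PauliVec.rotX, PauliVec.rotZ] <;>
    ring

/-- The effective observable computes the expectation of `X_i` after the circuit, for every input
state in which all qubits of the block but its first are clean. -/
theorem quadForm_circuitOn : ∀ (n : ℕ) (i : Fin (2 ^ n)) (e : Fin (2 ^ n) → Q),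
    Function.Injective e → ∀ (θ : Param n → ℝ) (ψ : (Q → Fin 2) → ℂ),
      (∀ j, j ≠ firstQubit n → IsClean (e j) ψ) →
      quadForm (circuitOn n e θ *ᵥ ψ) (onQubit (e i) pauliX) =
        quadForm ψ (onQubit (e (firstQubit n)) (pauliObs n i θ).toMatrix)
  | 0, i, e, _, θ, ψ, _ => by
    have hi : i = firstQubit 0 := Subsingleton.elim (α := Fin 1) _ _
    rw [hi, circuitOn, onQubit_mul, quadForm_mulVec, conjTranspose_onQubit, onQubit_mul,
      onQubit_mul, pauliX_eq_toMatrix, conjTranspose_RZ_mul_RX_mul_mul, pauliObs]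
    rfl
  | n + 1, i, e, he, θ, ψ, hψ => by
    have hab : e (upper n (firstQubit n)) ≠ e (lower n (firstQubit n)) :=
      he.ne (upper_ne_lower n _ _)
    have hb : IsClean (e (lower n (firstQubit n))) ψ :=
      hψ _ (by rw [← upper_firstQubit]; exact (upper_ne_lower n _ _).symm)
    set G := topLayer (e (upper n (firstQubit n))) (e (lower n (firstQubit n)))
      (θ (topParam n (0, 0))) (θ (topParam n (0, 1))) (θ (topParam n (1, 0)))
      (θ (topParam n (1, 1))) with hG
    set U := circuitOn n (e ∘ upper n) (fun p => θ (upperParam n p)) with hU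
    set L := circuitOn n (e ∘ lower n) (fun p => θ (lowerParam n p)) with hL
    have hcirc : circuitOn (n + 1) e θ *ᵥ ψ = L *ᵥ (U *ᵥ (G *ᵥ ψ)) := by
      have h : circuitOn (n + 1) e θ = L * U * cnot _ _ * (onQubit _ (RZ _) * onQubit _ (RZ _)) *
        (onQubit _ (RX _) * onQubit _ (RX _)) := rfl
      rw [h]
      simp only [hG, topLayer, mulVec_mulVec, Matrix.mul_assoc]
      rfl
    have hclean : ∀ q, q ≠ e (upper n (firstQubit n)) → q ≠ e (lower n (firstQubit n)) →
        IsClean q ψ → IsClean q (G *ᵥ ψ) := fun q hqa hqb hq =>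
      hq.mulVec_of_commute <| ((onQubit_commute_cnot hab hqa hqb _).mul_right
        ((onQubit_commute hqb _ _).mul_right (onQubit_commute hqa _ _))).mul_right
        ((onQubit_commute hqb _ _).mul_right (onQubit_commute hqa _ _))
    have heu := he.comp (upper_injective n)
    have hel := he.comp (lower_injective n)
    rw [hcirc]
    rcases exists_upper_or_lower n i with ⟨j, rfl⟩ | ⟨j, rfl⟩
    -- The circuit on the lower half is a unitary that commutes with the observable: drop it.
    · rw [quadForm_mulVec_of_commute _ (circuitOn_mem_unitary n _ hel _)
        (onQubit_commute_circuitOn n _ hel _ (fun k => he.ne (upper_ne_lower n j k).symm) _)]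
      refine (quadForm_circuitOn n j (e ∘ upper n) heu _ _ fun k hk => ?_).trans ?_
      · refine hclean _ (heu.ne hk) (he.ne (upper_ne_lower n _ _)) (hψ _ ?_)
        rw [← upper_firstQubit]
        exact (upper_injective n).ne hk
      · rw [Function.comp_apply, hG, quadForm_topLayer_control hab hb, pauliObs_upper,
          upper_firstQubit]
    -- Pull the observable back through the circuit on the lower half, which acts last; the circuit
    -- on the upper half keeps the lower qubits clean and commutes with the resulting observable.
    · refine (quadForm_circuitOn n j (e ∘ lower n) hel _ _ fun k hk => ?_).trans ?_
      · refine IsClean.mulVec_of_commute (hclean _ (he.ne (upper_ne_lower n _ _).symm)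
          (hel.ne hk) (hψ _ ?_)) (onQubit_commute_circuitOn n _ heu _
            (fun l => he.ne (upper_ne_lower n l k)) _)
        rw [← upper_firstQubit]
        exact (upper_ne_lower n _ _).symm
      · rw [Function.comp_apply, quadForm_mulVec_of_commute _ (circuitOn_mem_unitary n _ heu _)
          (onQubit_commute_circuitOn n _ heu _ (fun k => he.ne (upper_ne_lower n k _)) _),
          hG, quadForm_topLayer_target hab hb, pauliObs_lower,
          upper_firstQubit]

end Circuit

theorem isClean_zeroState {Q : Type} [Fintype Q] [DecidableEq Q] (q : Q) :
    IsClean q (zeroState : (Q → Fin 2) → ℂ) := by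
  rw [IsClean, zeroState, mulVec_single_one]
  ext b
  simp only [col_apply, onQubit, Pi.single_apply, funext_iff]
  have h2 : ∀ x : Fin 2, x = 0 ∨ x = 1 := by decide
  by_cases h : ∀ r, r ≠ q → b r = 0
  · rw [if_pos h]
    rcases h2 (b q) with hq | hq
    · have : ∀ r, b r = 0 := fun r => if hr : r = q then hr ▸ hq else h r hr
      simp [hq, this, proj0]
    · have : ¬ ∀ r, b r = 0 := fun hr => by simp [hr q] at hq
      simp [hq, this, proj0]
  · rw [if_neg h, if_neg fun hr => h fun r _ => hr r]

theorem cost_eq (n : ℕ) (i : Fin (2 ^ n)) (θ : Param n → ℝ) :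
    cost n i θ = (pauliObs n i θ).w + (pauliObs n i θ).z := by
  have h := quadForm_circuitOn n i id Function.injective_id θ zeroState
    fun j _ => isClean_zeroState j
  have h0 : ∀ A : Matrix (Fin 2) (Fin 2) ℂ,
      quadForm zeroState (onQubit (id (firstQubit n)) A) = A 0 0 := fun A => by
    simp [quadForm, zeroState, onQubit, Pi.star_single]
  rw [h0] at h
  have h' : cost n i θ = (quadForm (circuitOn n id θ *ᵥ zeroState) (onQubit (id i) pauliX)).re :=
    rfl
  rw [h', h]
  simp [PauliVec.toMatrix]

end QTTN

/-! ### Independent uniform angles -/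

namespace QTTN

/-- The uniform distribution of an angle on `[-π, π]`. -/
noncomputable abbrev uniformAngle : Measure ℝ :=
  cond (volume : Measure ℝ) (Set.Icc (-Real.pi) Real.pi)

instance isProbabilityMeasure_uniformAngle : IsProbabilityMeasure uniformAngle := by
  apply cond_isProbabilityMeasure_of_finite
  · simp [Real.pi_pos]
  · simp

theorem integral_uniformAngle (f : ℝ → ℝ) :
    ∫ t, f t ∂uniformAngle = (2 * Real.pi)⁻¹ * ∫ t in (-Real.pi)..Real.pi, f t := by
  have hpi := Real.pi_pos
  rw [uniformAngle, ProbabilityTheory.cond, integral_smul_measure,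
    intervalIntegral.integral_of_le (by linarith), integral_Icc_eq_integral_Ioc, smul_eq_mul]
  congr 1
  rw [Real.volume_Icc, ENNReal.toReal_inv, ENNReal.toReal_ofReal (by linarith)]
  ring

theorem integral_cos_uniformAngle : ∫ t, Real.cos t ∂uniformAngle = 0 := by
  rw [integral_uniformAngle]; simp

theorem integral_sin_uniformAngle : ∫ t, Real.sin t ∂uniformAngle = 0 := by
  rw [integral_uniformAngle]; simp

theorem integral_cos_sq_uniformAngle : ∫ t, Real.cos t ^ 2 ∂uniformAngle = 1 / 2 := by
  rw [integral_uniformAngle, integral_cos_sq]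
  have := Real.pi_pos.ne'
  simp
  field_simp

theorem integral_sin_sq_uniformAngle : ∫ t, Real.sin t ^ 2 ∂uniformAngle = 1 / 2 := by
  rw [integral_uniformAngle, integral_sin_sq]
  have := Real.pi_pos.ne'
  simp
  field_simp

theorem integral_sin_mul_cos_uniformAngle :
    ∫ t, Real.sin t * Real.cos t ∂uniformAngle = 0 := by
  rw [integral_uniformAngle, integral_sin_mul_cos₁]; simp

section Pi

variable {ι : Type} [Fintype ι]

/-- The joint distribution of independent uniform angles labelled by `ι`. -/
noncomputable abbrev uniformAngles (ι : Type) [Fintype ι] : Measure (ι → ℝ) :=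
  Measure.pi fun _ => uniformAngle

/-- The distribution of the angles has compact support, so continuous functions are integrable. -/
theorem integrable_uniformAngles_of_continuous {f : (ι → ℝ) → ℝ} (hf : Continuous f) :
    Integrable f (uniformAngles ι) := by
  have h : uniformAngle.restrict (Set.Icc (-Real.pi) Real.pi) = uniformAngle := by
    rw [uniformAngle, ProbabilityTheory.cond, Measure.restrict_smul,
      Measure.restrict_restrict measurableSet_Icc, Set.inter_self]
  have h2 := Measure.restrict_pi_pi (fun _ : ι => uniformAngle)
    fun _ => Set.Icc (-Real.pi) Real.pi
  simp only [h] at h2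
  rw [uniformAngles, ← h2]
  exact hf.continuousOn.integrableOn_compact (isCompact_univ_pi fun _ => isCompact_Icc)

variable [DecidableEq ι]

/-- Resampling one of the independent angles does not change their joint distribution. -/
theorem measurePreserving_update (p : ι) :
    MeasurePreserving (fun q : (ι → ℝ) × ℝ => Function.update q.1 p q.2)
      ((uniformAngles ι).prod uniformAngle) (uniformAngles ι) := by
  have hm : Measurable fun q : (ι → ℝ) × ℝ => Function.update q.1 p q.2 := by
    refine measurable_pi_lambda _ fun j => ?_
    by_cases h : j = p
    · subst h; simpa using measurable_snd
    · simpa [Function.update_of_ne h, Function.comp_def] using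
        (measurable_pi_apply (X := fun _ : ι => ℝ) j).comp (measurable_fst (β := ℝ))
  refine ⟨hm, (Measure.pi_eq fun s hs => ?_).symm⟩
  rw [Measure.map_apply hm (MeasurableSet.univ_pi hs)]
  have hpre : (fun q : (ι → ℝ) × ℝ => Function.update q.1 p q.2) ⁻¹' Set.univ.pi s =
      (Set.univ.pi (Function.update s p Set.univ)) ×ˢ s p := by
    ext ⟨θ, t⟩
    simp only [Set.mem_preimage, Set.mem_univ_pi, Set.mem_prod]
    constructor
    · intro h
      refine ⟨fun j => ?_, by simpa using h p⟩
      by_cases hj : j = p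
      · subst hj; simp
      · simpa [hj] using h j
    · rintro ⟨h, ht⟩ j
      by_cases hj : j = p
      · subst hj; simpa using ht
      · simpa [hj] using h j
  rw [hpre, Measure.prod_prod, Measure.pi_pi,
    ← Finset.mul_prod_erase _ _ (Finset.mem_univ p),
    ← Finset.mul_prod_erase Finset.univ (fun i => uniformAngle (s i)) (Finset.mem_univ p),
    Function.update_self, measure_univ, one_mul, mul_comm]
  congr 1
  refine Finset.prod_congr rfl fun j hj => ?_
  rw [Function.update_of_ne (Finset.ne_of_mem_erase hj)]

theorem integral_eq_integral_update (p : ι) {f : (ι → ℝ) → ℝ} (hf : Continuous f) :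
    ∫ θ, f θ ∂uniformAngles ι =
      ∫ θ, ∫ t, f (Function.update θ p t) ∂uniformAngle ∂uniformAngles ι := by
  have hp := measurePreserving_update p
  have hi := integrable_uniformAngles_of_continuous hf
  rw [← integral_prod (fun q : (ι → ℝ) × ℝ => f (Function.update q.1 p q.2))
    (hp.integrable_comp_of_integrable hi)]
  rw [← hp.map_eq, integral_map hp.measurable.aemeasurable hf.aestronglyMeasurable, hp.map_eq]

/-- A factor `g (θ p)` separates from a function which does not depend on the angle `p`. -/
theorem integral_mul_apply (p : ι) {A : (ι → ℝ) → ℝ} {g : ℝ → ℝ} (hA : Continuous A)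
    (hg : Continuous g) (hAp : ∀ θ t, A (Function.update θ p t) = A θ) :
    ∫ θ, A θ * g (θ p) ∂uniformAngles ι =
      (∫ θ, A θ ∂uniformAngles ι) * ∫ t, g t ∂uniformAngle := by
  rw [integral_eq_integral_update p (by fun_prop)]
  simp only [hAp, Function.update_self, integral_const_mul, integral_mul_const]

/-- Rotating by an independent uniform angle averages the second moments. -/
theorem integral_rotate_sq (p : ι) {A B : (ι → ℝ) → ℝ} (hA : Continuous A) (hB : Continuous B)
    (hAp : ∀ θ t, A (Function.update θ p t) = A θ)
    (hBp : ∀ θ t, B (Function.update θ p t) = B θ) :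
    ∫ θ, (A θ * Real.cos (θ p) + B θ * Real.sin (θ p)) ^ 2 ∂uniformAngles ι =
      ((∫ θ, A θ ^ 2 ∂uniformAngles ι) + ∫ θ, B θ ^ 2 ∂uniformAngles ι) / 2 := by
  have hexp : ∀ θ : ι → ℝ, (A θ * Real.cos (θ p) + B θ * Real.sin (θ p)) ^ 2 =
      A θ ^ 2 * Real.cos (θ p) ^ 2 + B θ ^ 2 * Real.sin (θ p) ^ 2 +
        2 * A θ * B θ * (Real.sin (θ p) * Real.cos (θ p)) := fun θ => by ring
  have h1 := integral_mul_apply p (A := fun θ => A θ ^ 2) (g := fun t => Real.cos t ^ 2)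
    (by fun_prop) (by fun_prop) (by simp [hAp])
  have h2 := integral_mul_apply p (A := fun θ => B θ ^ 2) (g := fun t => Real.sin t ^ 2)
    (by fun_prop) (by fun_prop) (by simp [hBp])
  have h3 := integral_mul_apply p (A := fun θ => 2 * A θ * B θ)
    (g := fun t => Real.sin t * Real.cos t) (by fun_prop) (by fun_prop) (by simp [hAp, hBp])
  simp only [hexp]
  rw [integral_add, integral_add, h1, h2, h3, integral_cos_sq_uniformAngle,
    integral_sin_sq_uniformAngle, integral_sin_mul_cos_uniformAngle]
  · ring
  all_goals exact integrable_uniformAngles_of_continuous (by fun_prop)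

theorem integral_sin_mul_sq (p : ι) {A : (ι → ℝ) → ℝ} (hA : Continuous A)
    (hAp : ∀ θ t, A (Function.update θ p t) = A θ) :
    ∫ θ, (Real.sin (θ p) * A θ) ^ 2 ∂uniformAngles ι = (∫ θ, A θ ^ 2 ∂uniformAngles ι) / 2 := by
  have h := integral_rotate_sq p (A := fun _ => 0) continuous_const hA (fun _ _ => rfl) hAp
  simpa [mul_comm] using h

theorem integral_mul_cos_sq (p : ι) {A : (ι → ℝ) → ℝ} (hA : Continuous A)
    (hAp : ∀ θ t, A (Function.update θ p t) = A θ) :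
    ∫ θ, (A θ * Real.cos (θ p)) ^ 2 ∂uniformAngles ι = (∫ θ, A θ ^ 2 ∂uniformAngles ι) / 2 := by
  have h := integral_rotate_sq p (B := fun _ => 0) hA continuous_const hAp (fun _ _ => rfl)
  simpa using h

/-- Rotating by an independent uniform angle makes the mean vanish. -/
theorem integral_rotate (p : ι) {A B : (ι → ℝ) → ℝ} (hA : Continuous A) (hB : Continuous B)
    (hAp : ∀ θ t, A (Function.update θ p t) = A θ)
    (hBp : ∀ θ t, B (Function.update θ p t) = B θ) :
    ∫ θ, (A θ * Real.cos (θ p) + B θ * Real.sin (θ p)) ∂uniformAngles ι = 0 := by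
  rw [integral_add (integrable_uniformAngles_of_continuous (by fun_prop))
    (integrable_uniformAngles_of_continuous (by fun_prop)),
    integral_mul_apply p hA Real.continuous_cos hAp,
    integral_mul_apply p hB Real.continuous_sin hBp, integral_cos_uniformAngle,
    integral_sin_uniformAngle]
  simp

end Pi

theorem measurePreserving_comp_inr {ι κ : Type} [Fintype ι] [Fintype κ] :
    MeasurePreserving (fun (θ : ι ⊕ κ → ℝ) k => θ (Sum.inr k)) (uniformAngles (ι ⊕ κ))
      (uniformAngles κ) :=
  measurePreserving_snd.comp (measurePreserving_sumPiEquivProdPi fun _ : ι ⊕ κ => uniformAngle)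

theorem measurePreserving_comp_inl {ι κ : Type} [Fintype ι] [Fintype κ] :
    MeasurePreserving (fun (θ : ι ⊕ κ → ℝ) k => θ (Sum.inl k)) (uniformAngles (ι ⊕ κ))
      (uniformAngles ι) :=
  measurePreserving_fst.comp (measurePreserving_sumPiEquivProdPi fun _ : ι ⊕ κ => uniformAngle)

/-- The parameters of the upper half are again independent and uniform. -/
theorem integral_comp_upper (n : ℕ) {f : (Param n → ℝ) → ℝ} (hf : Continuous f) :
    ∫ θ : Param (n + 1) → ℝ, f (fun p => θ (upperParam n p)) ∂uniformAngles (Param (n + 1)) =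
      ∫ θ, f θ ∂uniformAngles (Param n) := by
  have h : MeasurePreserving (fun (θ : Param (n + 1) → ℝ) p => θ (upperParam n p))
      (uniformAngles (Param (n + 1))) (uniformAngles (Param n)) :=
    measurePreserving_comp_inl.comp (measurePreserving_comp_inr (ι := Fin 2 × Fin 2)
      (κ := Param n ⊕ Param n))
  rw [← h.map_eq, integral_map h.measurable.aemeasurable hf.aestronglyMeasurable]

/-- The parameters of the lower half are again independent and uniform. -/
theorem integral_comp_lower (n : ℕ) {f : (Param n → ℝ) → ℝ} (hf : Continuous f) :
    ∫ θ : Param (n + 1) → ℝ, f (fun p => θ (lowerParam n p)) ∂uniformAngles (Param (n + 1)) =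
      ∫ θ, f θ ∂uniformAngles (Param n) := by
  have h : MeasurePreserving (fun (θ : Param (n + 1) → ℝ) p => θ (lowerParam n p))
      (uniformAngles (Param (n + 1))) (uniformAngles (Param n)) :=
    measurePreserving_comp_inr.comp (measurePreserving_comp_inr (ι := Fin 2 × Fin 2)
      (κ := Param n ⊕ Param n))
  rw [← h.map_eq, integral_map h.measurable.aemeasurable hf.aestronglyMeasurable]

end QTTN

/-! ### The gradient and the moments of the effective observable -/

namespace QTTN

theorem continuous_pauliObs : ∀ (n : ℕ) (i : Fin (2 ^ n)),
    (Continuous fun θ => (pauliObs n i θ).w) ∧ (Continuous fun θ => (pauliObs n i θ).x) ∧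
      (Continuous fun θ => (pauliObs n i θ).y) ∧ Continuous fun θ => (pauliObs n i θ).z
  | 0, i => by
    simp only [pauliObs, PauliVec.rot, PauliVec.rotX, PauliVec.rotZ]
    refine ⟨?_, ?_, ?_, ?_⟩ <;> fun_prop
  | n + 1, i => by
    rcases exists_upper_or_lower n i with ⟨j, rfl⟩ | ⟨j, rfl⟩ <;>
    obtain ⟨hw, hx, hy, hz⟩ := continuous_pauliObs n j
    · have hp : Continuous fun (θ : Param (n + 1) → ℝ) p => θ (upperParam n p) := by fun_prop
      have hw' := hw.comp hp
      have hx' := hx.comp hp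
      have hy' := hy.comp hp
      have hz' := hz.comp hp
      simp only [Function.comp_def] at hw' hx' hy' hz'
      simp only [pauliObs_upper, PauliVec.upperStep, PauliVec.rot, PauliVec.rotX, PauliVec.rotZ]
      refine ⟨?_, ?_, ?_, ?_⟩ <;> fun_prop
    · have hp : Continuous fun (θ : Param (n + 1) → ℝ) p => θ (lowerParam n p) := by fun_prop
      have hw' := hw.comp hp
      have hx' := hx.comp hp
      have hy' := hy.comp hp
      have hz' := hz.comp hp
      simp only [Function.comp_def] at hw' hx' hy' hz'
      simp only [pauliObs_lower, PauliVec.lowerStep, PauliVec.rot, PauliVec.rotX, PauliVec.rotZ]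
      refine ⟨?_, ?_, ?_, ?_⟩ <;> fun_prop

@[simp]
theorem update_topParam_of_ne {n : ℕ} (θ : Param (n + 1) → ℝ) (t : ℝ) {p q : Fin 2 × Fin 2}
    (h : q ≠ p) : Function.update θ (topParam n p) t (topParam n q) = θ (topParam n q) :=
  Function.update_of_ne (Sum.inl_injective.ne h) _ _

@[simp]
theorem update_topParam_upperParam {n : ℕ} (θ : Param (n + 1) → ℝ) (t : ℝ) (p : Fin 2 × Fin 2)
    (q : Param n) : Function.update θ (topParam n p) t (upperParam n q) = θ (upperParam n q) :=
  Function.update_of_ne Sum.inr_ne_inl _ _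

@[simp]
theorem update_topParam_lowerParam {n : ℕ} (θ : Param (n + 1) → ℝ) (t : ℝ) (p : Fin 2 × Fin 2)
    (q : Param n) : Function.update θ (topParam n p) t (lowerParam n q) = θ (lowerParam n q) :=
  Function.update_of_ne Sum.inr_ne_inl _ _

theorem param11_succ (n : ℕ) : param11 (n + 1) = topParam n (0, 0) := rfl

@[simp]
theorem update_param11_baseParamZ (θ : Param 0 → ℝ) (t : ℝ) :
    Function.update θ (param11 0) t baseParamZ = θ baseParamZ :=
  Function.update_of_ne (show (1 : Fin 2) ≠ 0 by decide) _ _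

/-- The parameter `(1,1)` belongs to the first gate in time, so in the Heisenberg picture it enters
the effective observable only through a final `X` rotation. -/
theorem exists_pauliObs_eq_rotX (n : ℕ) (i : Fin (2 ^ n)) :
    ∃ V : (Param n → ℝ) → PauliVec, (Continuous fun θ => (V θ).y) ∧
      (Continuous fun θ => (V θ).z) ∧
      (∀ θ t, V (Function.update θ (param11 n) t) = V θ) ∧
      ∀ θ, pauliObs n i θ = (V θ).rotX (θ (param11 n)) := by
  cases n with
  | zero =>
    refine ⟨fun θ => PauliVec.rotZ (θ baseParamZ) ⟨0, 1, 0, 0⟩, ?_, ?_, fun θ t => ?_,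
      fun θ => rfl⟩
    · simp only [PauliVec.rotZ]; fun_prop
    · simp only [PauliVec.rotZ]; fun_prop
    · simp
  | succ n =>
    rcases exists_upper_or_lower n i with ⟨j, rfl⟩ | ⟨j, rfl⟩ <;>
    obtain ⟨hw, hx, hy, hz⟩ := continuous_pauliObs n j
    · have hp : Continuous fun (θ : Param (n + 1) → ℝ) p => θ (upperParam n p) := by fun_prop
      have hx' := hx.comp hp
      have hy' := hy.comp hp
      have hz' := hz.comp hp
      simp only [Function.comp_def] at hx' hy' hz'
      refine ⟨_, ?_, ?_, ?_, pauliObs_upper n j⟩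
      · simp only [PauliVec.rotZ]; fun_prop
      · simp only [PauliVec.rotZ]; fun_prop
      · intro θ t; simp [param11_succ]
    · have hp : Continuous fun (θ : Param (n + 1) → ℝ) p => θ (lowerParam n p) := by fun_prop
      have hx' := hx.comp hp
      have hy' := hy.comp hp
      have hz' := hz.comp hp
      simp only [Function.comp_def] at hx' hy' hz'
      refine ⟨_, ?_, ?_, ?_, pauliObs_lower n j⟩
      · simp only [PauliVec.rotZ]; fun_prop
      · simp only [PauliVec.rotZ]; fun_prop
      · intro θ t; simp [param11_succ]

/-- Differentiating the `Z` coordinate along an `X` rotation gives minus the `Y` coordinate. -/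
theorem gradient_eq (n : ℕ) (i : Fin (2 ^ n)) (θ : Param n → ℝ) :
    gradient n (param11 n) i θ = -(pauliObs n i θ).y := by
  obtain ⟨V, -, -, hV, hobs⟩ := exists_pauliObs_eq_rotX n i
  have hfun : (fun t => cost n i (Function.update θ (param11 n) t)) =
      fun t => (V θ).w + ((V θ).z * Real.cos t - (V θ).y * Real.sin t) := by
    ext t
    rw [cost_eq, hobs, hV, Function.update_self]
    rfl
  have hd : HasDerivAt (fun t => (V θ).w + ((V θ).z * Real.cos t - (V θ).y * Real.sin t))
      ((V θ).z * -Real.sin (θ (param11 n)) - (V θ).y * Real.cos (θ (param11 n)))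
      (θ (param11 n)) :=
    (((Real.hasDerivAt_cos _).const_mul _).sub ((Real.hasDerivAt_sin _).const_mul _)).const_add _
  rw [gradient, hfun, hd.deriv, hobs]
  simp only [PauliVec.rotX]
  ring

/-- The second moment of the `X` coordinate of the effective observable. -/
noncomputable def momentX (n : ℕ) (i : Fin (2 ^ n)) : ℝ :=
  ∫ θ, (pauliObs n i θ).x ^ 2 ∂uniformAngles (Param n)

/-- The second moment of the `Y` coordinate of the effective observable. -/
noncomputable def momentY (n : ℕ) (i : Fin (2 ^ n)) : ℝ :=
  ∫ θ, (pauliObs n i θ).y ^ 2 ∂uniformAngles (Param n)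

theorem momentX_nonneg (n : ℕ) (i : Fin (2 ^ n)) : 0 ≤ momentX n i :=
  integral_nonneg fun _ => sq_nonneg _

theorem momentY_nonneg (n : ℕ) (i : Fin (2 ^ n)) : 0 ≤ momentY n i :=
  integral_nonneg fun _ => sq_nonneg _

/-- The variance is a second moment, because the uniform angle `(1,1)` makes the mean vanish. -/
theorem gradVar_eq_momentY (n : ℕ) (i : Fin (2 ^ n)) : gradVar n i = momentY n i := by
  obtain ⟨V, hy, hz, hV, hobs⟩ := exists_pauliObs_eq_rotX n i
  have hg : gradient n (param11 n) i = fun θ => -(pauliObs n i θ).y :=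
    funext fun θ => gradient_eq n i θ
  have huni : uniformParams n = uniformAngles (Param n) := rfl
  have hc := (continuous_pauliObs n i).2.2.1
  have hmean : ∫ θ, (pauliObs n i θ).y ∂uniformAngles (Param n) = 0 := by
    simp only [hobs, PauliVec.rotX]
    exact integral_rotate (param11 n) hy hz (fun θ t => by rw [hV]) fun θ t => by rw [hV]
  rw [gradVar, hg, huni, variance_of_integral_eq_zero (by exact hc.neg.measurable.aemeasurable)
    (by rw [integral_neg, hmean, neg_zero])]
  simp only [neg_sq]
  rfl

/-- The uniform angle `(1,1)` equidistributes the second moment over the `Y` and `Z`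
coordinates. -/
theorem integral_z_sq_eq_momentY (n : ℕ) (i : Fin (2 ^ n)) :
    ∫ θ, (pauliObs n i θ).z ^ 2 ∂uniformAngles (Param n) = momentY n i := by
  obtain ⟨V, hy, hz, hV, hobs⟩ := exists_pauliObs_eq_rotX n i
  have h1 := integral_rotate_sq (param11 n) hy hz (fun θ t => by rw [hV]) fun θ t => by rw [hV]
  have h2 := integral_rotate_sq (param11 n) hz (B := fun θ => -(V θ).y) hy.neg
    (fun θ t => by rw [hV]) fun θ t => by rw [hV]
  rw [momentY]
  simp only [hobs, PauliVec.rotX, sub_eq_add_neg, ← neg_mul]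
  refine h2.trans (Eq.trans ?_ h1.symm)
  simp only [neg_sq, add_comm]

theorem momentX_zero (i : Fin (2 ^ 0)) : momentX 0 i = 1 / 2 := by
  have h := integral_rotate_sq baseParamZ (A := fun _ => 1) (B := fun _ => 0)
    continuous_const continuous_const (fun _ _ => rfl) fun _ _ => rfl
  rw [momentX]
  simp only [pauliObs, PauliVec.rot, PauliVec.rotX, PauliVec.rotZ]
  refine h.trans ?_
  simp

theorem momentY_zero (i : Fin (2 ^ 0)) : momentY 0 i = 1 / 4 := by
  have h1 := integral_rotate_sq baseParamZ (A := fun _ => 0) (B := fun _ => -1)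
    continuous_const continuous_const (fun _ _ => rfl) fun _ _ => rfl
  have h0 := integral_mul_cos_sq (param11 0)
    (A := fun θ => 0 * Real.cos (θ baseParamZ) + (-1) * Real.sin (θ baseParamZ)) (by fun_prop)
    (by simp)
  rw [momentY]
  simp only [pauliObs, PauliVec.rot, PauliVec.rotX, PauliVec.rotZ]
  rw [h1] at h0
  refine Eq.trans ?_ (h0.trans ?_)
  · congr 1
    ext θ
    ring
  · simp
    norm_num

section Recursion

variable (n : ℕ) (i : Fin (2 ^ n))

/-- The second moment of an off-diagonal coordinate after one upper recursion step: the target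
qubit contributes a factor `1/4`, and the `Z` rotation of the control averages. -/
theorem integral_upper_offdiag_sq {A B : (Param n → ℝ) → ℝ} (hA : Continuous A)
    (hB : Continuous B) :
    ∫ θ : Param (n + 1) → ℝ, (Real.sin (θ (topParam n (1, 0))) * (Real.sin (θ (topParam n (1, 1))) *
      (A (fun p => θ (upperParam n p)) * Real.cos (θ (topParam n (0, 1))) +
        B (fun p => θ (upperParam n p)) * Real.sin (θ (topParam n (0, 1)))))) ^ 2
          ∂uniformAngles (Param (n + 1)) =
      ((∫ θ, A θ ^ 2 ∂uniformAngles (Param n)) + ∫ θ, B θ ^ 2 ∂uniformAngles (Param n)) / 8 := by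
  have hp : Continuous fun (θ : Param (n + 1) → ℝ) p => θ (upperParam n p) := by fun_prop
  have hA' : Continuous fun θ : Param (n + 1) → ℝ => A fun p => θ (upperParam n p) :=
    hA.comp hp
  have hB' : Continuous fun θ : Param (n + 1) → ℝ => B fun p => θ (upperParam n p) :=
    hB.comp hp
  have h1 := integral_sin_mul_sq (topParam n (1, 0))
    (A := fun θ => Real.sin (θ (topParam n (1, 1))) *
      (A (fun p => θ (upperParam n p)) * Real.cos (θ (topParam n (0, 1))) +
        B (fun p => θ (upperParam n p)) * Real.sin (θ (topParam n (0, 1))))) (by fun_prop)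
    (fun θ t => by simp)
  have h2 := integral_sin_mul_sq (topParam n (1, 1))
    (A := fun θ => A (fun p => θ (upperParam n p)) * Real.cos (θ (topParam n (0, 1))) +
        B (fun p => θ (upperParam n p)) * Real.sin (θ (topParam n (0, 1)))) (by fun_prop)
    (fun θ t => by simp)
  have h3 := integral_rotate_sq (topParam n (0, 1)) hA' hB'
    (fun θ t => by simp) (fun θ t => by simp)
  have h4 := integral_comp_upper n (f := fun θ => A θ ^ 2) (by fun_prop)
  have h5 := integral_comp_upper n (f := fun θ => B θ ^ 2) (by fun_prop)
  refine h1.trans ?_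
  rw [h2, h3]
  rw [h4, h5]
  ring

theorem momentX_upper :
    momentX (n + 1) (upper n i) = (momentX n i + momentY n i) / 8 := by
  obtain ⟨-, hx, hy, -⟩ := continuous_pauliObs n i
  have h := integral_upper_offdiag_sq n hx hy
  rw [momentX, momentX, momentY, ← h]
  simp only [pauliObs_upper, PauliVec.upperStep, PauliVec.rot, PauliVec.rotX, PauliVec.rotZ]
  congr 1
  ext θ
  ring

theorem momentY_upper :
    momentY (n + 1) (upper n i) = (momentX n i + momentY n i) / 16 + momentY n i / 2 := by
  obtain ⟨-, hx, hy, hz⟩ := continuous_pauliObs n i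
  have hp : Continuous fun (θ : Param (n + 1) → ℝ) p => θ (upperParam n p) := by fun_prop
  have hx' := hx.comp hp
  have hy' := hy.comp hp
  have hz' := hz.comp hp
  simp only [Function.comp_def] at hx' hy' hz'
  have h := integral_upper_offdiag_sq n (B := fun θ => -(pauliObs n i θ).x) hy hx.neg
  have hr := integral_rotate_sq (topParam n (0, 0))
    (A := fun θ => Real.sin (θ (topParam n (1, 0))) * (Real.sin (θ (topParam n (1, 1))) *
      ((pauliObs n i fun p => θ (upperParam n p)).y * Real.cos (θ (topParam n (0, 1))) +
        -(pauliObs n i fun p => θ (upperParam n p)).x * Real.sin (θ (topParam n (0, 1))))))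
    (by fun_prop) hz'
    (fun θ t => by simp)
    (fun θ t => by simp)
  have h4 := (integral_comp_upper n (f := fun θ => (pauliObs n i θ).z ^ 2) (by fun_prop)).trans
    (integral_z_sq_eq_momentY n i)
  simp only [neg_sq] at h
  rw [h, h4] at hr
  calc momentY (n + 1) (upper n i)
      = ((momentY n i + momentX n i) / 8 + momentY n i) / 2 := by
        refine Eq.trans ?_ hr
        rw [momentY]
        simp only [pauliObs_upper, PauliVec.upperStep, PauliVec.rot, PauliVec.rotX, PauliVec.rotZ]
        congr 1
        ext θ
        ring
    _ = (momentX n i + momentY n i) / 16 + momentY n i / 2 := by ring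

theorem momentX_lower : momentX (n + 1) (lower n i) = 0 := by
  rw [momentX]
  simp [pauliObs_lower, PauliVec.lowerStep, PauliVec.rot, PauliVec.rotX, PauliVec.rotZ]

theorem momentY_lower : momentY (n + 1) (lower n i) = 3 / 8 * momentY n i := by
  obtain ⟨-, -, hy, hz⟩ := continuous_pauliObs n i
  have hp : Continuous fun (θ : Param (n + 1) → ℝ) p => θ (lowerParam n p) := by fun_prop
  have hy' := hy.comp hp
  have hz' := hz.comp hp
  simp only [Function.comp_def] at hy' hz'
  have h1 := integral_mul_cos_sq (topParam n (1, 1)) hy'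
    (fun θ t => by simp)
  have h2 := integral_rotate_sq (topParam n (1, 0)) hz'
    (B := fun θ => -((pauliObs n i fun p => θ (lowerParam n p)).y *
      Real.cos (θ (topParam n (1, 1))))) (by fun_prop)
    (fun θ t => by simp)
    (fun θ t => by simp)
  have h3 := integral_sin_mul_sq (topParam n (0, 0))
    (A := fun θ => (pauliObs n i fun p => θ (lowerParam n p)).z *
      Real.cos (θ (topParam n (1, 0))) + -((pauliObs n i fun p => θ (lowerParam n p)).y *
      Real.cos (θ (topParam n (1, 1)))) * Real.sin (θ (topParam n (1, 0)))) (by fun_prop)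
    (fun θ t => by simp)
  have h4 := (integral_comp_lower n (f := fun θ => (pauliObs n i θ).z ^ 2) (by fun_prop)).trans
    (integral_z_sq_eq_momentY n i)
  have h5 : _ = momentY n i :=
    integral_comp_lower n (f := fun θ => (pauliObs n i θ).y ^ 2) (by fun_prop)
  simp only [neg_sq] at h2
  rw [h1, h4, h5] at h2
  rw [h2] at h3
  have hY : momentY (n + 1) (lower n i) = (momentY n i + momentY n i / 2) / 2 / 2 := by
    rw [← h3, momentY]
    simp only [pauliObs_lower, PauliVec.lowerStep, PauliVec.rot, PauliVec.rotX, PauliVec.rotZ]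
    congr 1
    ext θ
    ring
  rw [hY]
  ring

end Recursion

end QTTN

/-! ### Ordering and growth of the moments -/

namespace QTTN

theorem momentX_le_and_momentY_le_firstQubit : ∀ (n : ℕ) (i : Fin (2 ^ n)),
    momentX n i ≤ momentX n (firstQubit n) ∧ momentY n i ≤ momentY n (firstQubit n)
  | 0, i => by simp [momentX_zero, momentY_zero]
  | n + 1, i => by
    have hX := momentX_nonneg n (firstQubit n)
    have hY := momentY_nonneg n (firstQubit n)
    rw [← upper_firstQubit, momentX_upper, momentY_upper]
    rcases exists_upper_or_lower n i with ⟨j, rfl⟩ | ⟨j, rfl⟩ <;>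
    obtain ⟨h1, h2⟩ := momentX_le_and_momentY_le_firstQubit n j
    · rw [momentX_upper, momentY_upper]
      constructor <;> linarith
    · rw [momentX_lower, momentY_lower]
      constructor <;> linarith

theorem momentY_lastQubit (n : ℕ) : momentY n (lastQubit n) = 1 / 4 * (3 / 8) ^ n := by
  induction n with
  | zero => simp [momentY_zero]
  | succ n ih =>
    rw [← lower_lastQubit, momentY_lower, ih]
    ring

theorem momentY_lastQubit_le : ∀ (n : ℕ) (i : Fin (2 ^ n)),
    momentY n (lastQubit n) ≤ momentY n i
  | 0, i => by simp [momentY_zero]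
  | n + 1, i => by
    rw [← lower_lastQubit, momentY_lower]
    rcases exists_upper_or_lower n i with ⟨j, rfl⟩ | ⟨j, rfl⟩ <;>
    have h := momentY_lastQubit_le n j
    · have hX := momentX_nonneg n j
      have hY := momentY_nonneg n j
      rw [momentY_upper]
      linarith
    · rw [momentY_lower]
      linarith

/-- The largest eigenvalue of the transfer matrix. -/
noncomputable def topEigenvalue : ℝ := (11 + √57) / 8

/-- The characteristic equation of the transfer matrix, in the form in which it expresses that
`(4 λ - 8, 1)` is an eigenvector. -/
theorem topEigenvalue_char : (4 * topEigenvalue - 3) * (4 * topEigenvalue - 8) = 8 := by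
  have h := Real.sq_sqrt (show (0 : ℝ) ≤ 57 by norm_num)
  rw [topEigenvalue]
  linear_combination h / 4

theorem abs_topEigenvalue_sub_le : |topEigenvalue - 2.3187| ≤ 0.00005 := by
  have h1 : (7.5495 : ℝ) ≤ √57 := Real.le_sqrt_of_sq_le (by norm_num)
  have h2 : √57 ≤ (7.5499 : ℝ) := Real.sqrt_le_iff.mpr (by norm_num)
  rw [topEigenvalue, abs_le]
  constructor <;> linarith

theorem transferMatrix_mulVec (v : Fin 2 → ℝ) :
    transferMatrix.mulVec v = ![(3 * v 0 + 8 * v 1) / 4, (v 0 + 8 * v 1) / 4] := by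
  ext i
  fin_cases i <;> simp [transferMatrix, Matrix.mulVec, dotProduct, Fin.sum_univ_two] <;> ring

theorem isGreatest_topEigenvalue :
    IsGreatest {μ : ℝ | Module.End.HasEigenvalue (Matrix.toLin' transferMatrix) μ}
      topEigenvalue := by
  constructor
  · refine Module.End.hasEigenvalue_of_hasEigenvector
      (x := ![4 * topEigenvalue - 8, 1]) ⟨?_, fun h => by simpa using congrFun h 1⟩
    have h := topEigenvalue_char
    rw [Module.End.mem_eigenspace_iff, Matrix.toLin'_apply, transferMatrix_mulVec]
    ext i
    fin_cases i
    · simp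
      linear_combination (-1 / 4) * h
    · simp
  · intro μ hμ
    obtain ⟨v, hv⟩ := hμ.exists_hasEigenvector
    have h := hv.apply_eq_smul
    rw [Matrix.toLin'_apply, transferMatrix_mulVec] at h
    have h0 : (3 * v 0 + 8 * v 1) / 4 = μ * v 0 := by simpa using congrFun h 0
    have h1 : (v 0 + 8 * v 1) / 4 = μ * v 1 := by simpa using congrFun h 1
    have hv1 : v 1 ≠ 0 := fun hz => hv.2 <| by
      ext i
      fin_cases i
      · rw [hz] at h1
        simp only [Fin.zero_eta, Pi.zero_apply]
        linarith
      · exact hz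
    -- Eliminating `v 0` from the eigenvector equations leaves the characteristic equation.
    have hchar : (8 * μ - 11) ^ 2 = 57 := by
      apply mul_right_cancel₀ hv1
      linear_combination (-16) * h0 - (64 * μ - 48) * h1
    have := Real.le_sqrt_of_sq_le hchar.le
    rw [topEigenvalue]
    linarith

/-- The vector of moments `(E x² + E y², E z²)` of the first qubit evolves by a quarter of the
transfer matrix, and it lies between two multiples of the Perron eigenvector
`(4 λ - 8, 1)`. -/
theorem moments_firstQubit_bounds (n : ℕ) :
    ((4 * topEigenvalue - 8) * (1 / 4 * (topEigenvalue / 4) ^ n) ≤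
        momentX n (firstQubit n) + momentY n (firstQubit n) ∧
      1 / 4 * (topEigenvalue / 4) ^ n ≤ momentY n (firstQubit n)) ∧
    momentX n (firstQubit n) + momentY n (firstQubit n) ≤
        (4 * topEigenvalue - 8) * (topEigenvalue / 4) ^ n ∧
      momentY n (firstQubit n) ≤ (topEigenvalue / 4) ^ n := by
  have hl := abs_le.mp abs_topEigenvalue_sub_le
  have hchar := topEigenvalue_char
  induction n with
  | zero =>
    simp only [momentX_zero, momentY_zero, pow_zero]
    refine ⟨⟨?_, ?_⟩, ?_, ?_⟩ <;> linarith [hl.1, hl.2]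
  | succ n ih =>
    obtain ⟨⟨h1, h2⟩, h3, h4⟩ := ih
    rw [← upper_firstQubit, momentX_upper, momentY_upper]
    -- the first row of the eigenvector equation for `(4 λ - 8, 1)`, scaled by `r / 4`
    have hrow : ∀ r : ℝ, (4 * topEigenvalue - 8) * (r * (topEigenvalue / 4)) =
        3 / 16 * ((4 * topEigenvalue - 8) * r) + r / 2 := fun r => by
      linear_combination r / 16 * hchar
    have hS := hrow ((topEigenvalue / 4) ^ n)
    rw [pow_succ]
    refine ⟨⟨?_, ?_⟩, ?_, ?_⟩ <;> linarith

/-- A geometric sequence in `n` is a power of `2 ^ n`. -/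
theorem exists_rpow_neg_eq_pow {r : ℝ} (h0 : 0 < r) (h1 : r < 1) :
    ∃ a : ℝ, 0 < a ∧ ∀ n : ℕ, ((2 ^ n : ℕ) : ℝ) ^ (-a) = r ^ n := by
  refine ⟨-Real.logb 2 r, neg_pos.mpr (Real.logb_neg one_lt_two h0 h1), fun n => ?_⟩
  rw [neg_neg, Nat.cast_pow, Nat.cast_ofNat, ← Real.rpow_natCast, ← Real.rpow_mul zero_le_two,
    mul_comm, Real.rpow_mul zero_le_two, Real.rpow_logb two_pos one_lt_two.ne' h0,
    Real.rpow_natCast]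

end QTTN

theorem mainTheorem3 :
    -- ordering: `X_1` has the largest and `X_N` the smallest variance
    (∀ n : ℕ, 1 ≤ n → ∀ i : Fin (2 ^ n),
      QTTN.gradVar n i ≤ QTTN.gradVar n (QTTN.firstQubit n) ∧
      QTTN.gradVar n (QTTN.lastQubit n) ≤ QTTN.gradVar n i) ∧
    -- exact value for `X_N`
    (∀ n : ℕ, 1 ≤ n →
      QTTN.gradVar n (QTTN.lastQubit n) = (1 / 4 : ℝ) * (3 / 8 : ℝ) ^ n) ∧
    -- lower bound for `X_1` in terms of the top eigenvalue
    (∃ lam : ℝ,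
      IsGreatest {μ : ℝ | Module.End.HasEigenvalue (Matrix.toLin' QTTN.transferMatrix) μ} lam ∧
      |lam - 2.3187| ≤ 0.00005 ∧
      ∃ c : ℝ, 0 < c ∧ ∀ n : ℕ, 1 ≤ n →
        c * (lam / 4) ^ n ≤ QTTN.gradVar n (QTTN.firstQubit n)) ∧
    -- all variances decay polynomially, and not faster, in the number `2 ^ n` of qubits
    (∃ c C a b : ℝ, 0 < c ∧ 0 < C ∧ 0 < a ∧ 0 < b ∧
      ∀ n : ℕ, 1 ≤ n → ∀ i : Fin (2 ^ n),
        c * ((2 ^ n : ℕ) : ℝ) ^ (-a) ≤ QTTN.gradVar n i ∧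
        QTTN.gradVar n i ≤ C * ((2 ^ n : ℕ) : ℝ) ^ (-b)) := by
  have hl := abs_le.mp QTTN.abs_topEigenvalue_sub_le
  obtain ⟨a, ha, hapow⟩ := QTTN.exists_rpow_neg_eq_pow (r := 3 / 8) (by norm_num) (by norm_num)
  obtain ⟨b, hb, hbpow⟩ := QTTN.exists_rpow_neg_eq_pow (r := QTTN.topEigenvalue / 4)
    (by linarith [hl.1]) (by linarith [hl.2])
  simp only [QTTN.gradVar_eq_momentY]
  refine ⟨fun n _ i =>
      ⟨(QTTN.momentX_le_and_momentY_le_firstQubit n i).2, QTTN.momentY_lastQubit_le n i⟩,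
    fun n _ => QTTN.momentY_lastQubit n,
    ⟨QTTN.topEigenvalue, QTTN.isGreatest_topEigenvalue, QTTN.abs_topEigenvalue_sub_le, 1 / 4,
      by norm_num,
      fun n _ => (QTTN.moments_firstQubit_bounds n).1.2⟩,
    1 / 4, 1, a, b, by norm_num, one_pos, ha, hb, fun n _ i => ⟨?_, ?_⟩⟩
  · rw [hapow, ← QTTN.momentY_lastQubit]
    exact QTTN.momentY_lastQubit_le n i
  · rw [hbpow, one_mul]
    exact (QTTN.momentX_le_and_momentY_le_firstQubit n i).2.trans
      (QTTN.moments_firstQubit_bounds n).2.2
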